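/- All algebras are complex. For a Banach algebra $A$ (with or without unit) let $K(A)$ be the set of its compact elements, i.e. of those $a\in A$ for which the operator $A\to A$, $x\mapsto axa$, is compact. A uniform algebra is a commutative Banach algebra (with or without unit) such that $\|a^2\|=\|a\|^2$ for all $a$. Let $B(\ell_2)$ and $K(\ell_2)$ denote the bounded and the compact operators on $\ell_2=\ell_2(\mathbb N)$, and let $M(A)$ denote the multiplier algebra (the algebra of double centralizers) of a C$^*$-algebra $A$. **Corollary.** Let $X$ satisfy at least one of the following conditions: 1. $X$ is a separable uniform algebra or a separable abelian C$^*$-algebra, and $K(X)=\{0\}$; 2. $X=M(A)$, where $A$ is a separable non-unital C$^*$-algebra (not necessarily commutative) with no non-zero compact elements, i.e. $K(A)=\{0\}$. Then there is an isometric and isomorphic copy of $X$ inside $(B(\ell_2)\setminus K(\ell_2))\cup\{0\}$. That is, there is an isometric (complex-linear, multiplicative) algebra homomorphism $\varphi:X\to B(\ell_2)$ with $\varphi(X)\subseteq (B(\ell_2)\setminus K(\ell_2))\cup\{0\}$; when $X$ is a C$^*$-algebra (the abelian C$^*$-algebra case of (1), and case (2)), $\varphi$ can be taken to be a $^*$-homomorphism.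 Moreover, the diagonal map $\Phi:\ell_\infty\to B(\ell_2)$, $(\Phi(f)g)(n)=f(n)g(n)$, is an isometric unital $^*$-homomorphism, and $\Phi(c_0)=K(\ell_2)\cap\Phi(\ell_\infty)$. -/

import Mathlib

/-! The ampliation `T ↦ T ⊗ 1` from `B(H)` to `B(H ⊗ ℓ₂)` is an isometric `⋆`-homomorphism whose
only compact value is `0`: it repeats `T` in infinitely many orthogonal blocks. If `H` is
separable, `H ⊗ ℓ₂` embeds isometrically in `ℓ₂`, so it suffices to represent each algebra
isometrically on some separable Hilbert space. A separable uniform algebra embeds in `ℓ∞`, acting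
diagonally on `ℓ₂`, because by the spectral radius formula in the unitization every point of a
countable dense set is normed by a character. For a separable C⋆-algebra `A`, a weighted sum of
states norming the elements `a⋆a` of a countable dense set is a faithful positive functional; its
GNS space is separable, and `M(A)` acts on it boundedly because `(ma)⋆(ma) ≤ ‖m‖² a⋆a`, and
faithfully, hence isometrically. -/

open scoped MultiplierAlgebra ENNReal Topology

/-- `K(A)`: the compact elements of a normed algebra `A`, i.e. those `a` for which the operator
`U_a : A → A, x ↦ a x a` is compact. -/
def compactElements (A : Type*) [NonUnitalNormedRing A] : Set A :=
  {a | IsCompactOperator (fun x : A => a * x * a)}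

/-- A commutative complex Banach algebra (with or without a unit) is a uniform algebra when
`‖a ^ 2‖ = ‖a‖ ^ 2` for all `a`, equivalently when its Gelfand transform is isometric. -/
def IsUniformAlgebra (A : Type*) [NonUnitalNormedCommRing A] [NormedSpace ℂ A]
    [IsScalarTower ℂ A A] [SMulCommClass ℂ A A] [CompleteSpace A] : Prop :=
  ∀ a : A, ‖a * a‖ = ‖a‖ ^ 2

/-- `A` has a two-sided multiplicative identity. (The zero algebra has one.) -/
def HasUnit (A : Type*) [NonUnitalNormedRing A] : Prop :=
  ∃ e : A, ∀ a : A, e * a = a ∧ a * e = a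

/-- The complex Hilbert space `ℓ₂(ℕ)`. -/
abbrev EllTwo : Type := lp (fun _ : ℕ => ℂ) 2

/-- The C⋆-algebra `ℓ∞` of bounded complex sequences. -/
abbrev EllInfty : Type := lp (fun _ : ℕ => ℂ) ∞

/-- `c₀`, as a subset of `ℓ∞`. -/
def cZero : Set EllInfty :=
  {f | Filter.Tendsto (fun n : ℕ => f n) Filter.atTop (𝓝 0)}

/-- `B(ℓ₂)`, the bounded operators on `ℓ₂(ℕ)`. -/
abbrev BoundedOps : Type := EllTwo →L[ℂ] EllTwo

/-- `K(ℓ₂)`, the compact operators on `ℓ₂(ℕ)`. -/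
def compactOps : Set BoundedOps :=
  {T | IsCompactOperator (T : EllTwo → EllTwo)}

section Separated

theorem finite_of_totallyBounded_of_pairwise_le_dist {ι α : Type*} [PseudoMetricSpace α]
    {f : ι → α} {ε : ℝ} (hf : TotallyBounded (Set.range f)) (hε : 0 < ε)
    (hsep : Pairwise fun i j => ε ≤ dist (f i) (f j)) : Finite ι := by
  obtain ⟨t, ht, hcover⟩ := Metric.totallyBounded_iff.1 hf (ε / 2) (half_pos hε)
  have hcenter : ∀ i, ∃ c : t, dist (f i) c < ε / 2 := fun i => by
    simpa using hcover ⟨i, rfl⟩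
  choose c hc using hcenter
  have hc_inj : Function.Injective c := fun i j hij => by
    by_contra hne
    have htri := dist_triangle_right (f i) (f j) (c i)
    have hj := hc j
    rw [← hij] at hj
    linarith [hsep hne, hc i]
  have := ht.to_subtype
  exact Finite.of_injective c hc_inj

theorem countable_of_pairwise_le_dist {ι α : Type*} [PseudoMetricSpace α]
    [TopologicalSpace.SeparableSpace α] {f : ι → α} {ε : ℝ} (hε : 0 < ε)
    (hsep : Pairwise fun i j => ε ≤ dist (f i) (f j)) : Countable ι := by
  refine Set.countable_univ_iff.1 <| Set.PairwiseDisjoint.countable_of_isOpen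
    (s := fun i => Metric.ball (f i) (ε / 2)) (fun i _ j _ hij => ?_)
    (fun _ _ => Metric.isOpen_ball) fun _ _ => Metric.nonempty_ball.2 (half_pos hε)
  exact Metric.ball_disjoint_ball (by linarith [hsep hij])

end Separated

section BlockDiagonal

variable {ι 𝕜 : Type*} {p : ℝ≥0∞} [Fact (1 ≤ p)] {E F : ι → Type*}
  [∀ i, NormedAddCommGroup (E i)] [∀ i, NormedAddCommGroup (F i)]

theorem norm_le_dist_single [DecidableEq ι] {i j : ι} (hij : i ≠ j) (a : E i) (b : E j) :
    ‖a‖ ≤ dist (lp.single p i a) (lp.single p j b) := by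
  have hp : p ≠ 0 := (zero_lt_one.trans_le Fact.out).ne'
  simpa [dist_eq_norm, hij] using
    lp.norm_apply_le_norm hp (lp.single p i a - lp.single p j b) i

section NontriviallyNormedField

variable [NontriviallyNormedField 𝕜] [∀ i, NormedSpace 𝕜 (E i)] [∀ i, NormedSpace 𝕜 (F i)]
  {T : ∀ i, E i →L[𝕜] F i} {K : ℝ} (hK : 0 ≤ K) (hTK : ∀ i, ‖T i‖ ≤ K)

theorem mapCLM_single [DecidableEq ι] (i : ι) (x : E i) :
    lp.mapCLM p T hK hTK (lp.single p i x) = lp.single p i (T i x) := by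
  ext j
  exact Pi.apply_single (fun j => T j) (fun j => map_zero (T j)) i x j

theorem evalCLM_comp_mapCLM_comp_single [DecidableEq ι] (i : ι) :
    lp.evalCLM 𝕜 F p i ∘L lp.mapCLM p T hK hTK ∘L lp.singleContinuousLinearMap 𝕜 E p i = T i := by
  ext x
  exact (congrArg (fun y : lp F p => y i) (mapCLM_single hK hTK i x)).trans
    (lp.single_apply_self p i _)

theorem norm_le_norm_mapCLM (i : ι) : ‖T i‖ ≤ ‖lp.mapCLM p T hK hTK‖ := by
  classical
  have hp : 0 < p := zero_lt_one.trans_le Fact.out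
  refine (T i).opNorm_le_bound (norm_nonneg _) fun x => ?_
  have h := (lp.mapCLM p T hK hTK).le_opNorm (lp.single p i x)
  rwa [mapCLM_single, lp.norm_single hp, lp.norm_single hp] at h

variable (p) in
theorem norm_mapCLM_sub_sum_le [DecidableEq ι] (s : Finset ι) {ε : ℝ} (hε : 0 ≤ ε)
    (hs : ∀ i ∉ s, ‖T i‖ ≤ ε) :
    ‖lp.mapCLM p T hK hTK - ∑ i ∈ s,
      lp.singleContinuousLinearMap 𝕜 F p i ∘L T i ∘L lp.evalCLM 𝕜 E p i‖ ≤ ε := by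
  have hbound : ∀ i, ‖(if i ∈ s then 0 else T i : E i →L[𝕜] F i)‖ ≤ ε := fun i => by
    split_ifs with hi
    · simpa using hε
    · exact hs i hi
  convert lp.norm_mapCLM_le p _ hε hbound
  ext x i
  have heval : ∀ j, lp.evalCLM 𝕜 E p j x = x j := fun _ => rfl
  have hsum : (∑ j ∈ s, lp.single p j (T j (x j))) i = if i ∈ s then T i (x i) else 0 := by
    rw [lp.coeFn_sum, Finset.sum_apply]
    simp only [lp.coeFn_single, Finset.sum_pi_single]
  simp only [sub_apply, sum_apply, ContinuousLinearMap.comp_apply, heval,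
    lp.singleContinuousLinearMap_apply, lp.coeFn_sub, Pi.sub_apply, hsum, lp.mapCLM_apply_coe]
  split_ifs <;> simp

variable {hK hTK}

theorem isCompactOperator_of_mapCLM (h : IsCompactOperator (lp.mapCLM p T hK hTK)) (i : ι) :
    IsCompactOperator (T i) := by
  classical
  rw [← evalCLM_comp_mapCLM_comp_single (p := p) hK hTK i]
  exact (h.comp_clm (lp.singleContinuousLinearMap 𝕜 E p i)).clm_comp (lp.evalCLM 𝕜 F p i)

theorem isCompactOperator_mapCLM [∀ i, CompleteSpace (F i)] (hT : ∀ i, IsCompactOperator (T i))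
    (hT0 : Filter.Tendsto (fun i => ‖T i‖) Filter.cofinite (𝓝 0)) :
    IsCompactOperator (lp.mapCLM p T hK hTK) := by
  classical
  have hmem : ∀ i, lp.singleContinuousLinearMap 𝕜 F p i ∘L T i ∘L lp.evalCLM 𝕜 E p i ∈
      compactOperator (RingHom.id 𝕜) (lp E p) (lp F p) := fun i =>
    ((hT i).comp_clm (lp.evalCLM 𝕜 E p i)).clm_comp (lp.singleContinuousLinearMap 𝕜 F p i)
  refine isCompactOperator_of_tendsto (l := Filter.atTop) (F := fun s : Finset ι => ∑ i ∈ s,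
    lp.singleContinuousLinearMap 𝕜 F p i ∘L T i ∘L lp.evalCLM 𝕜 E p i) ?_
    (.of_forall fun s => ?_)
  · refine Metric.tendsto_atTop.2 fun ε hε => ?_
    have hfin : {i | ε / 2 ≤ ‖T i‖}.Finite := by
      simpa [Filter.eventually_cofinite] using Metric.tendsto_nhds.1 hT0 (ε / 2) (half_pos hε)
    refine ⟨hfin.toFinset, fun s hs => ?_⟩
    rw [dist_comm, dist_eq_norm]
    refine (norm_mapCLM_sub_sum_le p hK hTK s (half_pos hε).le fun i hi => ?_).trans_lt
      (half_lt_self hε)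
    contrapose! hi
    exact hs (hfin.mem_toFinset.2 hi.le)
  · exact Submodule.sum_mem _ fun i _ => hmem i

end NontriviallyNormedField

section DenselyNormedField

variable [DenselyNormedField 𝕜] [∀ i, NormedSpace 𝕜 (E i)] [∀ i, NormedSpace 𝕜 (F i)]
  {T : ∀ i, E i →L[𝕜] F i} {K : ℝ} {hK : 0 ≤ K} {hTK : ∀ i, ‖T i‖ ≤ K}

theorem finite_setOf_le_norm_of_isCompactOperator_mapCLM
    (h : IsCompactOperator (lp.mapCLM p T hK hTK)) {ε : ℝ} (hε : 0 < ε) :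
    {i | ε ≤ ‖T i‖}.Finite := by
  classical
  have hp : 0 < p := zero_lt_one.trans_le Fact.out
  have hlarge : ∀ i : {i | ε ≤ ‖T i‖}, ∃ x, ‖x‖ < 1 ∧ ε / 2 < ‖T i x‖ := fun i =>
    (T i).exists_lt_apply_of_lt_opNorm ((half_lt_self hε).trans_le i.2)
  choose x hx hTx using hlarge
  obtain ⟨C, hC, hsub⟩ := IsCompactOperator.image_closedBall_subset_compact
    (f := (lp.mapCLM p T hK hTK : lp E p →ₗ[𝕜] lp F p)) h 1
  have hmem : Set.range (fun i : {i | ε ≤ ‖T i‖} => lp.single p i.1 (T i (x i))) ⊆ C := by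
    rintro _ ⟨i, rfl⟩
    refine hsub ⟨lp.single p i.1 (x i), ?_, mapCLM_single hK hTK _ _⟩
    rw [mem_closedBall_zero_iff, lp.norm_single hp]
    exact (hx i).le
  refine finite_of_totallyBounded_of_pairwise_le_dist (hC.totallyBounded.subset hmem)
    (half_pos hε) fun i j hij => (hTx i).le.trans (norm_le_dist_single ?_ _ _)
  exact Subtype.coe_injective.ne hij

theorem tendsto_norm_of_isCompactOperator_mapCLM (h : IsCompactOperator (lp.mapCLM p T hK hTK)) :
    Filter.Tendsto (fun i => ‖T i‖) Filter.cofinite (𝓝 0) := by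
  refine Metric.tendsto_nhds.2 fun ε hε => ?_
  simpa [Filter.eventually_cofinite] using finite_setOf_le_norm_of_isCompactOperator_mapCLM h hε

theorem isCompactOperator_mapCLM_iff [∀ i, CompleteSpace (F i)] :
    IsCompactOperator (lp.mapCLM p T hK hTK) ↔
      (∀ i, IsCompactOperator (T i)) ∧
        Filter.Tendsto (fun i => ‖T i‖) Filter.cofinite (𝓝 0) :=
  ⟨fun h => ⟨isCompactOperator_of_mapCLM h, tendsto_norm_of_isCompactOperator_mapCLM h⟩,
    fun h => isCompactOperator_mapCLM h.1 h.2⟩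

end DenselyNormedField

end BlockDiagonal

theorem adjoint_mapCLM {ι 𝕜 : Type*} [RCLike 𝕜] {E F : ι → Type*}
    [∀ i, NormedAddCommGroup (E i)] [∀ i, InnerProductSpace 𝕜 (E i)] [∀ i, CompleteSpace (E i)]
    [∀ i, NormedAddCommGroup (F i)] [∀ i, InnerProductSpace 𝕜 (F i)] [∀ i, CompleteSpace (F i)]
    (T : ∀ i, E i →L[𝕜] F i) {K : ℝ} (hK : 0 ≤ K) (hTK : ∀ i, ‖T i‖ ≤ K) :
    (lp.mapCLM 2 T hK hTK).adjoint =
      lp.mapCLM 2 (fun i => (T i).adjoint) hK (fun i => by simpa using hTK i) := by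
  refine ((ContinuousLinearMap.eq_adjoint_iff _ _).2 fun x y => ?_).symm
  simp only [lp.inner_eq_tsum, lp.mapCLM_apply_coe, ContinuousLinearMap.adjoint_inner_left]

section Diagonal

variable {ι 𝕜 : Type*} [RCLike 𝕜]

theorem norm_mul_apply_le (f : lp (fun _ : ι => 𝕜) ∞) (i : ι) :
    ‖ContinuousLinearMap.mul 𝕜 𝕜 (f i)‖ ≤ ‖f‖ := by
  rw [ContinuousLinearMap.opNorm_mul_apply]
  exact lp.norm_apply_le_norm ENNReal.top_ne_zero f i

variable (ι 𝕜) in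
/-- The diagonal representation of `ℓ∞` on `ℓ₂`: a bounded family `f` acts as multiplication
by `f`, i.e. as the block-diagonal operator with the scalars `f i` as its blocks. -/
noncomputable def diagonal :
    lp (fun _ : ι => 𝕜) ∞ →⋆ₐ[𝕜] (lp (fun _ : ι => 𝕜) 2 →L[𝕜] lp (fun _ : ι => 𝕜) 2) where
  toFun f := lp.mapCLM 2 (fun i => ContinuousLinearMap.mul 𝕜 𝕜 (f i)) (norm_nonneg f)
    (norm_mul_apply_le f)
  map_one' := ContinuousLinearMap.ext fun g => lp.ext <| funext fun i => one_mul (g i)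
  map_zero' := ContinuousLinearMap.ext fun g => lp.ext <| funext fun i => zero_mul (g i)
  map_mul' f h := ContinuousLinearMap.ext fun g => lp.ext <| funext fun i =>
    mul_assoc (f i) (h i) (g i)
  map_add' f h := ContinuousLinearMap.ext fun g => lp.ext <| funext fun i =>
    add_mul (f i) (h i) (g i)
  commutes' c := ContinuousLinearMap.ext fun g => lp.ext <| funext fun i =>
    congrArg (· * g i) (Algebra.algebraMap_self_apply c)
  map_star' f := by
    refine (ContinuousLinearMap.eq_adjoint_iff _ _).2 fun x y => ?_
    simp only [lp.inner_eq_tsum, lp.mapCLM_apply_coe, lp.star_apply,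
      ContinuousLinearMap.mul_apply', RCLike.inner_apply, map_mul, RCLike.star_def,
      RCLike.conj_conj]
    exact tsum_congr fun i => by ring

theorem diagonal_apply (f : lp (fun _ : ι => 𝕜) ∞) (g : lp (fun _ : ι => 𝕜) 2) (i : ι) :
    diagonal ι 𝕜 f g i = f i * g i := rfl

theorem isometry_diagonal : Isometry (diagonal ι 𝕜) := by
  refine AddMonoidHomClass.isometry_of_norm _ fun f => le_antisymm
    (lp.norm_mapCLM_le 2 _ (norm_nonneg f) (norm_mul_apply_le f)) ?_
  refine lp.norm_le_of_forall_le (norm_nonneg _) fun i => ?_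
  exact (ContinuousLinearMap.opNorm_mul_apply 𝕜 𝕜 (f i)).ge.trans
    (norm_le_norm_mapCLM (norm_nonneg f) (norm_mul_apply_le f) i)

theorem isCompactOperator_diagonal_iff {f : lp (fun _ : ι => 𝕜) ∞} :
    IsCompactOperator (diagonal ι 𝕜 f) ↔ Filter.Tendsto f Filter.cofinite (𝓝 0) := by
  refine (isCompactOperator_mapCLM_iff (hK := norm_nonneg f)
    (hTK := norm_mul_apply_le f)).trans ?_
  simp only [ContinuousLinearMap.opNorm_mul_apply]
  rw [← tendsto_zero_iff_norm_tendsto_zero]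
  exact and_iff_right fun i => isCompactOperator_of_locallyCompactSpace_rng _

end Diagonal

theorem diagonal_image_cZero :
    diagonal ℕ ℂ '' cZero = compactOps ∩ Set.range (diagonal ℕ ℂ) := by
  have hmem (f : EllInfty) : diagonal ℕ ℂ f ∈ compactOps ↔ f ∈ cZero := by
    refine isCompactOperator_diagonal_iff.trans ?_
    rw [Nat.cofinite_eq_atTop]
    rfl
  rw [Set.inter_comm, ← Set.image_preimage_eq_range_inter]
  exact congrArg _ (Set.ext fun f => (hmem f).symm)

section Ampliation

variable (ι 𝕜 : Type*) [RCLike 𝕜] (H : Type*) [NormedAddCommGroup H] [InnerProductSpace 𝕜 H]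
  [CompleteSpace H]

/-- The ampliation `T ↦ T ⊗ 1` of the bounded operators on `H` to `H ⊗ ℓ₂(ι)`, the latter being
realised as `ℓ₂(ι, H)`, on which `T` acts coordinatewise. -/
noncomputable def ampliation :
    (H →L[𝕜] H) →⋆ₙₐ[𝕜] (lp (fun _ : ι => H) 2 →L[𝕜] lp (fun _ : ι => H) 2) where
  toFun T := lp.mapCLM 2 (fun _ => T) (norm_nonneg T) fun _ => le_rfl
  map_smul' c T := by ext; simp
  map_zero' := by ext; simp
  map_add' S T := by ext; simp
  map_mul' S T := by ext; simp
  map_star' T := by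
    simp only [ContinuousLinearMap.star_eq_adjoint, adjoint_mapCLM, LinearIsometryEquiv.norm_map]

theorem isometry_ampliation [Nonempty ι] : Isometry (ampliation ι 𝕜 H) :=
  AddMonoidHomClass.isometry_of_norm _ fun T =>
    le_antisymm (lp.norm_mapCLM_le 2 _ (norm_nonneg T) fun _ => le_rfl)
      (norm_le_norm_mapCLM (norm_nonneg T) (fun _ => le_rfl) (Classical.arbitrary ι))

variable {ι 𝕜 H}

theorem eq_zero_of_isCompactOperator_ampliation [Infinite ι] {T : H →L[𝕜] H}
    (hT : IsCompactOperator (ampliation ι 𝕜 H T)) : T = 0 :=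
  norm_eq_zero.1 <| tendsto_nhds_unique tendsto_const_nhds <|
    tendsto_norm_of_isCompactOperator_mapCLM (T := fun _ : ι => T) (hK := norm_nonneg T)
      (hTK := fun _ => le_rfl) hT

end Ampliation

section Conjugation

variable {𝕜 E F : Type*} [RCLike 𝕜] [NormedAddCommGroup E] [InnerProductSpace 𝕜 E]
  [CompleteSpace E] [NormedAddCommGroup F] [InnerProductSpace 𝕜 F] [CompleteSpace F]

/-- Conjugation `T ↦ V T V⋆` by an isometry `V`, which need not be surjective; it is therefore
in general not unital. -/
noncomputable def conjIsometry (V : E →ₗᵢ[𝕜] F) : (E →L[𝕜] E) →⋆ₙₐ[𝕜] (F →L[𝕜] F) where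
  toFun T := V.toContinuousLinearMap ∘L T ∘L V.toContinuousLinearMap.adjoint
  map_smul' c T := by simp
  map_zero' := by simp
  map_add' S T := by simp
  map_mul' S T := by
    have h (x : E) : V.toContinuousLinearMap.adjoint (V x) = x :=
      congrArg (fun S : E →L[𝕜] E => S x) V.adjoint_comp_self
    ext x
    simp [h]
  map_star' T := by
    simp [ContinuousLinearMap.star_eq_adjoint, ContinuousLinearMap.adjoint_comp,
      ContinuousLinearMap.comp_assoc]

theorem adjoint_comp_conjIsometry_comp (V : E →ₗᵢ[𝕜] F) (T : E →L[𝕜] E) :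
    V.toContinuousLinearMap.adjoint ∘L conjIsometry V T ∘L V.toContinuousLinearMap = T := by
  have h (x : E) : V.toContinuousLinearMap.adjoint (V x) = x :=
    congrArg (fun S : E →L[𝕜] E => S x) V.adjoint_comp_self
  ext x
  simp [conjIsometry, h]

theorem isCompactOperator_of_conjIsometry {V : E →ₗᵢ[𝕜] F} {T : E →L[𝕜] E}
    (h : IsCompactOperator (conjIsometry V T)) : IsCompactOperator T := by
  rw [← adjoint_comp_conjIsometry_comp V T]
  exact (h.comp_clm V.toContinuousLinearMap).clm_comp V.toContinuousLinearMap.adjoint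

theorem isometry_conjIsometry (V : E →ₗᵢ[𝕜] F) : Isometry (conjIsometry V) := by
  refine AddMonoidHomClass.isometry_of_norm _ fun T => ?_
  calc ‖conjIsometry V T‖
      = ‖T ∘L V.toContinuousLinearMap.adjoint‖ := V.norm_toContinuousLinearMap_comp
    _ = ‖V.toContinuousLinearMap ∘L T.adjoint‖ := by
      rw [← LinearIsometryEquiv.norm_map ContinuousLinearMap.adjoint]
      simp [ContinuousLinearMap.adjoint_comp]
    _ = ‖T.adjoint‖ := V.norm_toContinuousLinearMap_comp
    _ = ‖T‖ := LinearIsometryEquiv.norm_map _ T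

end Conjugation

section Separable

variable {ι 𝕜 : Type*} [RCLike 𝕜]

variable (𝕜) in
theorem separableSpace_lp [Countable ι] {p : ℝ≥0∞} [Fact (1 ≤ p)] (hp : p ≠ ∞) (E : ι → Type*)
    [∀ i, NormedAddCommGroup (E i)] [∀ i, NormedSpace 𝕜 (E i)]
    [∀ i, TopologicalSpace.SeparableSpace (E i)] :
    TopologicalSpace.SeparableSpace (lp E p) := by
  classical
  have hsep : TopologicalSpace.IsSeparable (⋃ i, Set.range (lp.single p (E := E) i)) :=
    .iUnion fun i => TopologicalSpace.isSeparable_range (lp.isometry_single i).continuous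
  rw [← TopologicalSpace.isSeparable_univ_iff]
  refine (hsep.span (R := 𝕜)).closure.mono fun f _ => ?_
  refine mem_closure_of_tendsto (lp.hasSum_single hp f) (.of_forall fun s => ?_)
  exact Submodule.sum_mem _ fun i _ => Submodule.subset_span (Set.mem_iUnion.2 ⟨i, f i, rfl⟩)

variable {E : Type*} [NormedAddCommGroup E] [InnerProductSpace 𝕜 E]
  [TopologicalSpace.SeparableSpace E]

theorem countable_of_orthonormal {v : ι → E} (hv : Orthonormal 𝕜 v) : Countable ι := by
  refine countable_of_pairwise_le_dist one_pos (f := v) fun i j hij => ?_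
  have h := norm_sub_sq (𝕜 := 𝕜) (v i) (v j)
  rw [hv.2 hij, hv.1 i, hv.1 j, map_zero] at h
  change 1 ≤ dist (v i) (v j)
  rw [dist_eq_norm, ← one_le_sq_iff₀ (norm_nonneg _), h]
  norm_num

variable (𝕜 E)

theorem nonempty_linearIsometry_lp_two [Infinite ι] [CompleteSpace E] :
    Nonempty (E →ₗᵢ[𝕜] lp (fun _ : ι => 𝕜) 2) := by
  classical
  obtain ⟨w, b, -⟩ := exists_hilbertBasis 𝕜 E
  have : Countable w := countable_of_orthonormal b.orthonormal
  obtain ⟨e, he⟩ := exists_injective_nat w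
  let i : w → ι := Infinite.natEmbedding ι ∘ e
  have hi : Function.Injective i := (Infinite.natEmbedding ι).injective.comp he
  have ho : Orthonormal 𝕜 fun k => (lp.single 2 (i k) 1 : lp (fun _ : ι => 𝕜) 2) := by
    refine ⟨fun k => by simp [lp.norm_single], fun k l hkl => ?_⟩
    refine (lp.inner_single_left _ _ _).trans ?_
    rw [lp.single_apply_ne _ _ _ (hi.ne hkl), inner_zero_right]
  exact ⟨ho.orthogonalFamily.linearIsometry.comp b.repr.toLinearIsometry⟩

end Separable

theorem exists_isometry_range_subset_noncompact (H : Type*) [NormedAddCommGroup H]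
    [InnerProductSpace ℂ H] [CompleteSpace H] [TopologicalSpace.SeparableSpace H] :
    ∃ Ψ : (H →L[ℂ] H) →⋆ₙₐ[ℂ] BoundedOps,
      Isometry Ψ ∧ Set.range Ψ ⊆ (Set.univ \ compactOps) ∪ {0} := by
  have := separableSpace_lp ℂ (p := 2) ENNReal.ofNat_ne_top fun _ : ℕ => H
  obtain ⟨V⟩ := nonempty_linearIsometry_lp_two (ι := ℕ) ℂ (lp (fun _ : ℕ => H) 2)
  refine ⟨(conjIsometry V).comp (ampliation ℕ ℂ H),
    (isometry_conjIsometry V).comp (isometry_ampliation ℕ ℂ H), ?_⟩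
  rintro _ ⟨T, rfl⟩
  refine or_iff_not_imp_left.2 fun hT => ?_
  have hcompact : IsCompactOperator (conjIsometry V (ampliation ℕ ℂ H T)) := by
    by_contra h
    exact hT ⟨trivial, h⟩
  have hT0 := eq_zero_of_isCompactOperator_ampliation (isCompactOperator_of_conjIsometry hcompact)
  rw [hT0, map_zero]
  rfl

section Characters

theorem spectralRadius_eq_nnnorm_of_norm_pow_two_pow {U : Type*} [NormedRing U]
    [NormedAlgebra ℂ U] [CompleteSpace U] {a : U} (ha : ∀ n : ℕ, ‖a ^ 2 ^ n‖ = ‖a‖ ^ 2 ^ n) :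
    spectralRadius ℂ a = ‖a‖₊ := by
  have hlim := (spectrum.pow_nnnorm_pow_one_div_tendsto_nhds_spectralRadius a).comp
    (tendsto_pow_atTop_atTop_of_one_lt (one_lt_two (α := ℕ)))
  refine tendsto_nhds_unique hlim (tendsto_const_nhds.congr fun n => ?_)
  have hn : ‖a ^ 2 ^ n‖₊ = ‖a‖₊ ^ 2 ^ n := Subtype.ext (ha n)
  rw [Function.comp_apply, hn, ENNReal.coe_pow, ← ENNReal.rpow_natCast, ← ENNReal.rpow_mul,
    mul_one_div_cancel (by positivity), ENNReal.rpow_one]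

section Unital

variable {U : Type*} [NormedCommRing U] [NormedAlgebra ℂ U] (a : U)

theorem nnnorm_apply_le_spectralRadius (f : WeakDual.characterSpace ℂ U) :
    (‖f a‖₊ : ℝ≥0∞) ≤ spectralRadius ℂ a :=
  le_iSup₂ (f := fun k (_ : k ∈ spectrum ℂ a) => (‖k‖₊ : ℝ≥0∞)) (f a)
    (WeakDual.CharacterSpace.apply_mem_spectrum f a)

theorem exists_nnnorm_apply_eq_spectralRadius [CompleteSpace U] [Nontrivial U] :
    ∃ f : WeakDual.characterSpace ℂ U, (‖f a‖₊ : ℝ≥0∞) = spectralRadius ℂ a := by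
  obtain ⟨k, hk, hka⟩ := spectrum.exists_nnnorm_eq_spectralRadius a
  obtain ⟨f, rfl⟩ := WeakDual.CharacterSpace.mem_spectrum_iff_exists.1 hk
  exact ⟨f, hka⟩

end Unital

variable {X : Type*} [NonUnitalNormedCommRing X] [NormedSpace ℂ X] [IsScalarTower ℂ X X]
  [SMulCommClass ℂ X X]

/-- The `ℓ¹`-unitization of a commutative normed algebra, as a commutative normed ring. It is
through its characters that the non-unital algebra `X` acquires multiplicative functionals. -/
noncomputable abbrev unitizationNormedCommRing : NormedCommRing (WithLp 1 (Unitization ℂ X)) where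
  __ := WithLp.instUnitizationNormedRing (𝕜 := ℂ) (A := X)
  mul_comm a b := congrArg (WithLp.toLp 1) (mul_comm (WithLp.ofLp a) (WithLp.ofLp b))

variable [CompleteSpace X]

theorem IsUniformAlgebra.norm_toLp_inr_pow_two_pow (hX : IsUniformAlgebra X) (a : X) (n : ℕ) :
    ‖(WithLp.toLp 1 (a : Unitization ℂ X)) ^ 2 ^ n‖ =
      ‖WithLp.toLp 1 (a : Unitization ℂ X)‖ ^ 2 ^ n := by
  induction n generalizing a with
  | zero => simp
  | succ n ih =>
    have hsq : (WithLp.toLp 1 (a : Unitization ℂ X)) ^ 2 =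
        WithLp.toLp 1 ((a * a : X) : Unitization ℂ X) := by
      rw [sq, Unitization.inr_mul]
      rfl
    rw [pow_succ', pow_mul, pow_mul, hsq, ih, WithLp.unitization_norm_inr,
      WithLp.unitization_norm_inr, hX a]

theorem IsUniformAlgebra.spectralRadius_toLp_inr (hX : IsUniformAlgebra X) (a : X) :
    spectralRadius ℂ (WithLp.toLp 1 (a : Unitization ℂ X)) = ‖a‖₊ := by
  rw [spectralRadius_eq_nnnorm_of_norm_pow_two_pow (hX.norm_toLp_inr_pow_two_pow a),
    WithLp.unitization_nnnorm_inr]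

theorem IsUniformAlgebra.exists_character_norm_eq (hX : IsUniformAlgebra X) (a : X) :
    ∃ χ : X →ₙₐ[ℂ] ℂ, (∀ x, ‖χ x‖ ≤ ‖x‖) ∧ ‖χ a‖ = ‖a‖ := by
  let := unitizationNormedCommRing (X := X)
  have : Nontrivial (WithLp 1 (Unitization ℂ X)) := (WithLp.equiv 1 _).nontrivial
  obtain ⟨f, hf⟩ := exists_nnnorm_apply_eq_spectralRadius (WithLp.toLp 1 (a : Unitization ℂ X))
  let F : Unitization ℂ X →ₐ[ℂ] ℂ := (WeakDual.CharacterSpace.toAlgHom f).comp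
    (WithLp.unitizationAlgEquiv (𝕜 := ℂ) (A := X) ℂ).symm.toAlgHom
  refine ⟨(F : Unitization ℂ X →ₙₐ[ℂ] ℂ).comp (Unitization.inrNonUnitalAlgHom ℂ X),
    fun x => ?_, ?_⟩
  · have hx := nnnorm_apply_le_spectralRadius (WithLp.toLp 1 (x : Unitization ℂ X)) f
    rw [hX.spectralRadius_toLp_inr] at hx
    exact ENNReal.coe_le_coe.1 hx
  · rw [hX.spectralRadius_toLp_inr] at hf
    exact congrArg NNReal.toReal (ENNReal.coe_inj.1 hf)

end Characters

section GelfandTransform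

variable {ι 𝕜 X : Type*} [NontriviallyNormedField 𝕜] [NonUnitalNormedRing X] [NormedSpace 𝕜 X]
  {χ : ι → X →ₙₐ[𝕜] 𝕜} (hχ : ∀ i x, ‖χ i x‖ ≤ ‖x‖)

/-- The Gelfand transform of `X` restricted to a family `χ` of contractive multiplicative
functionals, with values in the bounded families of scalars. -/
def gelfandTransformOn : X →ₙₐ[𝕜] lp (fun _ : ι => 𝕜) ∞ where
  toFun x := ⟨fun i => χ i x, memℓp_infty ⟨‖x‖, Set.forall_mem_range.2 fun i => hχ i x⟩⟩
  map_smul' c x := lp.ext <| funext fun i => map_smul (χ i) c x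
  map_zero' := lp.ext <| funext fun i => map_zero (χ i)
  map_add' x y := lp.ext <| funext fun i => map_add (χ i) x y
  map_mul' x y := lp.ext <| funext fun i => map_mul (χ i) x y

theorem isometry_gelfandTransformOn {d : ι → X} (hd : DenseRange d)
    (hχd : ∀ i, ‖χ i (d i)‖ = ‖d i‖) : Isometry (gelfandTransformOn hχ) := by
  have hle (x : X) : ‖gelfandTransformOn hχ x‖ ≤ ‖x‖ :=
    lp.norm_le_of_forall_le (norm_nonneg x) fun i => hχ i x
  have hcont : Continuous (gelfandTransformOn hχ) :=
    AddMonoidHomClass.continuous_of_bound _ 1 (by simpa using hle)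
  have hnorm : (fun x => ‖gelfandTransformOn hχ x‖) = norm :=
    hd.equalizer hcont.norm continuous_norm <| funext fun i => (hle (d i)).antisymm <|
      (hχd i).ge.trans <|
        lp.norm_apply_le_norm ENNReal.top_ne_zero (gelfandTransformOn hχ (d i)) i
  exact AddMonoidHomClass.isometry_of_norm _ (congrFun hnorm)

end GelfandTransform

theorem IsUniformAlgebra.exists_isometry_ellInfty {X : Type*} [NonUnitalNormedCommRing X]
    [NormedSpace ℂ X] [IsScalarTower ℂ X X] [SMulCommClass ℂ X X] [CompleteSpace X]
    [TopologicalSpace.SeparableSpace X] (hX : IsUniformAlgebra X) :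
    ∃ θ : X →ₙₐ[ℂ] EllInfty, Isometry θ := by
  choose χ hχ hχd using fun n => hX.exists_character_norm_eq (TopologicalSpace.denseSeq X n)
  exact ⟨gelfandTransformOn hχ,
    isometry_gelfandTransformOn hχ (TopologicalSpace.denseRange_denseSeq X) hχd⟩

section States

open scoped ComplexOrder

section Unital

variable {U : Type*} [CStarAlgebra U]

theorem norm_add_smul_I_one_sq_le [Nontrivial U] {a : U} (ha : IsSelfAdjoint a) (t : ℝ) :
    ‖a + (t * Complex.I : ℂ) • (1 : U)‖ ^ 2 ≤ ‖a‖ ^ 2 + t ^ 2 := by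
  have hmul : star (a + (t * Complex.I : ℂ) • (1 : U)) * (a + (t * Complex.I : ℂ) • (1 : U)) =
      a * a + ((t : ℂ) ^ 2) • (1 : U) := by
    have ht : (t : ℂ) ^ 2 = -((t * Complex.I) * (t * Complex.I)) := by
      linear_combination (t : ℂ) ^ 2 * Complex.I_sq
    have hstar : star (t * Complex.I : ℂ) = -(t * Complex.I) := by simp
    rw [ht, star_add, star_smul, hstar, ha.star_eq, star_one]
    simp only [add_mul, mul_add, smul_mul_assoc, mul_smul_comm, one_mul, mul_one]
    module
  calc ‖a + (t * Complex.I : ℂ) • (1 : U)‖ ^ 2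
      = ‖a * a + ((t : ℂ) ^ 2) • (1 : U)‖ := by rw [sq, ← CStarRing.norm_star_mul_self, hmul]
    _ ≤ ‖a * a‖ + ‖((t : ℂ) ^ 2) • (1 : U)‖ := norm_add_le _ _
    _ ≤ ‖a‖ ^ 2 + t ^ 2 := by
      refine add_le_add ((norm_mul_le a a).trans_eq (sq _).symm) (le_of_eq ?_)
      rw [norm_smul, norm_one, mul_one, norm_pow, Complex.norm_real, Real.norm_eq_abs, sq_abs]

variable {g : StrongDual ℂ U}

theorem im_apply_eq_zero_of_isSelfAdjoint (hg : ‖g‖ ≤ 1) (hg1 : g 1 = 1) {a : U}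
    (ha : IsSelfAdjoint a) : (g a).im = 0 := by
  have : Nontrivial U := ⟨1, 0, fun h => by simp [h] at hg1⟩
  have hbound (t : ℝ) : 2 * t * (g a).im ≤ ‖a‖ ^ 2 := by
    have him : (g (a + (t * Complex.I : ℂ) • (1 : U))).im = (g a).im + t := by simp [hg1]
    have hle := (Complex.abs_im_le_norm _).trans (g.le_of_opNorm_le hg (a + (t * Complex.I) • 1))
    rw [him, one_mul] at hle
    nlinarith [sq_le_sq.2 (hle.trans (le_abs_self _)), norm_add_smul_I_one_sq_le ha t,
      sq_nonneg (g a).im]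
  by_contra hne
  have hlarge := hbound ((‖a‖ ^ 2 + 1) / (2 * (g a).im))
  have hcancel : 2 * ((‖a‖ ^ 2 + 1) / (2 * (g a).im)) * (g a).im = ‖a‖ ^ 2 + 1 := by field_simp
  linarith

theorem apply_nonneg_of_norm_le_one [PartialOrder U] [StarOrderedRing U] (hg : ‖g‖ ≤ 1)
    (hg1 : g 1 = 1) {a : U} (ha : 0 ≤ a) : 0 ≤ g a := by
  have : Nontrivial U := ⟨1, 0, fun h => by simp [h] at hg1⟩
  have hle : a ≤ algebraMap ℝ U ‖a‖ := (IsSelfAdjoint.of_nonneg ha).le_algebraMap_norm_self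
  have hnorm : ‖algebraMap ℝ U ‖a‖ - a‖ ≤ ‖a‖ :=
    (CStarAlgebra.norm_le_norm_of_nonneg_of_le (sub_nonneg.2 hle) (sub_le_self _ ha)).trans_eq
      (by rw [norm_algebraMap', norm_norm])
  have hmap : g (algebraMap ℝ U ‖a‖ - a) = ‖a‖ - g a := by
    rw [map_sub, Algebra.algebraMap_eq_smul_one, ← Complex.coe_smul, map_smul, hg1, smul_eq_mul,
      mul_one]
  have hre := (Complex.re_le_norm _).trans
    ((g.le_of_opNorm_le hg (algebraMap ℝ U ‖a‖ - a)).trans_eq (one_mul _))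
  rw [hmap, Complex.sub_re, Complex.ofReal_re] at hre
  exact Complex.nonneg_iff.2
    ⟨by linarith, (im_apply_eq_zero_of_isSelfAdjoint hg hg1 (.of_nonneg ha)).symm⟩

theorem exists_strongDual_apply_eq_of_mem_spectrum {a : U} [IsStarNormal a] {k : ℂ}
    (hk : k ∈ spectrum ℂ a) : ∃ g : StrongDual ℂ U, ‖g‖ ≤ 1 ∧ g 1 = 1 ∧ g a = k := by
  have : Nontrivial U := by
    by_contra h
    rw [not_nontrivial_iff_subsingleton] at h
    simp [spectrum.of_subsingleton] at hk
  let S := StarAlgebra.elemental ℂ a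
  let b : S := ⟨a, StarAlgebra.elemental.self_mem ℂ a⟩
  have hkb : k ∈ spectrum ℂ b := by
    rwa [StarSubalgebra.spectrum_eq (hS := StarAlgebra.elemental.isClosed ℂ a)]
  obtain ⟨χ, rfl⟩ := WeakDual.CharacterSpace.mem_spectrum_iff_exists.1 hkb
  obtain ⟨g, hg, hnorm⟩ := exists_extension_norm_eq S.toSubalgebra.toSubmodule
    (WeakDual.toStrongDual (χ : WeakDual ℂ S))
  refine ⟨g, ?_, (hg (1 : S)).trans (map_one χ), hg b⟩
  exact hnorm.trans_le ((WeakDual.CharacterSpace.norm_le_norm_one χ).trans_eq norm_one)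

theorem exists_strongDual_apply_eq_norm [Nontrivial U] [PartialOrder U] [StarOrderedRing U]
    {a : U} (ha : 0 ≤ a) : ∃ g : StrongDual ℂ U, ‖g‖ ≤ 1 ∧ g 1 = 1 ∧ g a = ‖a‖ :=
  have : IsStarNormal a := (IsSelfAdjoint.of_nonneg ha).isStarNormal
  exists_strongDual_apply_eq_of_mem_spectrum <|
    (spectrum.algebraMap_mem_iff ℂ (R := ℝ)).2 (CStarAlgebra.norm_mem_spectrum_of_nonneg ha)

end Unital

variable {A : Type*} [NonUnitalCStarAlgebra A] [PartialOrder A]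

theorem eq_zero_of_forall_apply_star_mul_self_eq_zero {ι : Type*} {d : ι → A}
    (hd : DenseRange d) {s : ι → A →ₚ[ℂ] ℂ} (hs : ∀ i a, ‖s i a‖ ≤ ‖a‖)
    (hsd : ∀ i, s i (star (d i) * d i) = ‖star (d i) * d i‖) {x : A}
    (hx : ∀ i, s i (star x * x) = 0) : x = 0 := by
  have hle (y : A) : ‖star y * y‖ ≤ ‖star y * y - star x * x‖ := by
    refine hd.induction_on (p := fun y => ‖star y * y‖ ≤ ‖star y * y - star x * x‖) y
      (isClosed_le (by fun_prop) (by fun_prop)) fun i => ?_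
    calc ‖star (d i) * d i‖
        = ‖s i (star (d i) * d i - star x * x)‖ := by
          rw [map_sub, hx, sub_zero, hsd, Complex.norm_real, norm_norm]
      _ ≤ ‖star (d i) * d i - star x * x‖ := hs i _
  refine CStarRing.star_mul_self_eq_zero_iff x |>.1 (norm_le_zero_iff.1 ?_)
  simpa using hle x

variable [StarOrderedRing A]

theorem exists_positiveLinearMap_apply_eq_norm {a : A} (ha : 0 ≤ a) :
    ∃ f : A →ₚ[ℂ] ℂ, (∀ b, ‖f b‖ ≤ ‖b‖) ∧ f a = ‖a‖ := by
  let _ : PartialOrder (Unitization ℂ A) := CStarAlgebra.spectralOrder _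
  have _ : StarOrderedRing (Unitization ℂ A) := CStarAlgebra.spectralOrderedRing _
  obtain ⟨g, hg, hg1, hga⟩ := exists_strongDual_apply_eq_norm (Unitization.inr_nonneg_iff.2 ha)
  refine ⟨PositiveLinearMap.mk₀ (g.toLinearMap ∘ₗ Unitization.inrHom ℂ ℂ A) fun b hb =>
    apply_nonneg_of_norm_le_one hg hg1 (Unitization.inr_nonneg_iff.2 hb), fun b => ?_, ?_⟩
  · exact (g.le_of_opNorm_le hg _).trans_eq ((one_mul _).trans (Unitization.norm_inr (𝕜 := ℂ) b))
  · exact hga.trans (congrArg _ (Unitization.norm_inr (𝕜 := ℂ) a))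

theorem exists_positiveLinearMap_forall_apply_eq_zero {s : ℕ → A →ₚ[ℂ] ℂ}
    (hs : ∀ n a, ‖s n a‖ ≤ ‖a‖) :
    ∃ f : A →ₚ[ℂ] ℂ, ∀ a, 0 ≤ a → f a = 0 → ∀ n, s n a = 0 := by
  have hsum (a : A) : Summable fun n => (1 / 2 : ℂ) ^ n * s n a := by
    refine .of_norm_bounded (summable_geometric_two.mul_right ‖a‖) fun n => ?_
    simpa using mul_le_mul_of_nonneg_left (hs n a) (by positivity : (0 : ℝ) ≤ (2 ^ n)⁻¹)
  have hpos (a : A) (ha : 0 ≤ a) (n : ℕ) : 0 ≤ (1 / 2 : ℂ) ^ n * s n a :=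
    mul_nonneg (pow_nonneg (by norm_num [Complex.nonneg_iff]) n) ((s n).map_nonneg ha)
  let f : A →ₗ[ℂ] ℂ :=
    { toFun := fun a => ∑' n, (1 / 2 : ℂ) ^ n * s n a
      map_add' := fun a b => by
        simp only [map_add, mul_add]
        exact (hsum a).tsum_add (hsum b)
      map_smul' := fun c a => by
        simp only [map_smul, smul_eq_mul, RingHom.id_apply, mul_left_comm _ c]
        exact tsum_mul_left }
  refine ⟨PositiveLinearMap.mk₀ f fun a ha => tsum_nonneg (hpos a ha), fun a ha hfa n => ?_⟩
  have hzero : HasSum (fun n => (1 / 2 : ℂ) ^ n * s n a) 0 := hfa ▸ (hsum a).hasSum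
  simpa using congrFun ((hasSum_zero_iff_of_nonneg (hpos a ha)).1 hzero) n

variable (A) in
theorem exists_faithful_positiveLinearMap [TopologicalSpace.SeparableSpace A] :
    ∃ f : A →ₚ[ℂ] ℂ, ∀ x, f (star x * x) = 0 → x = 0 := by
  choose s hs hsd using fun n => exists_positiveLinearMap_apply_eq_norm
    (star_mul_self_nonneg (TopologicalSpace.denseSeq A n))
  obtain ⟨f, hf⟩ := exists_positiveLinearMap_forall_apply_eq_zero hs
  exact ⟨f, fun x hx => eq_zero_of_forall_apply_star_mul_self_eq_zero
    (TopologicalSpace.denseRange_denseSeq A) hs hsd (hf _ (star_mul_self_nonneg x) hx)⟩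

end States

theorem exists_norm_sq_sub_star_mul_self_eq {B : Type*} [CStarAlgebra B] (b : B) :
    ∃ c : B, algebraMap ℝ B (‖b‖ ^ 2) - star b * b = star c * c := by
  let _ : PartialOrder B := CStarAlgebra.spectralOrder B
  have _ : StarOrderedRing B := CStarAlgebra.spectralOrderedRing B
  refine CStarAlgebra.nonneg_iff_eq_star_mul_self.1 (sub_nonneg.2 ?_)
  rw [sq, ← CStarRing.norm_star_mul_self]
  exact (IsSelfAdjoint.star_mul_self b).le_algebraMap_norm_self

section MultiplierRepresentation

open scoped ComplexOrder InnerProductSpace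
open UniformSpace

variable {A : Type*} [NonUnitalCStarAlgebra A]

theorem star_mul_star_fst_apply (m : 𝓜(ℂ, A)) (a b : A) :
    star a * (star m).fst b = star (m.fst a) * b := by
  rw [DoubleCentralizer.star_fst, ← star_mul, m.central, star_mul, star_star]

theorem exists_norm_sq_smul_sub_star_fst_mul_fst_eq (m : 𝓜(ℂ, A)) :
    ∃ n : 𝓜(ℂ, A), ∀ a,
      ((‖m‖ : ℂ) ^ 2) • (star a * a) - star (m.fst a) * m.fst a = star (n.fst a) * n.fst a := by
  obtain ⟨n, hn⟩ := exists_norm_sq_sub_star_mul_self_eq m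
  refine ⟨n, fun a => ?_⟩
  have happly := congrArg (fun k : 𝓜(ℂ, A) => star a * k.fst a) hn
  simp only [DoubleCentralizer.sub_fst, DoubleCentralizer.mul_fst, sub_apply,
    mul_apply_eq_comp, mul_sub, star_mul_star_fst_apply,
    Algebra.algebraMap_eq_smul_one] at happly
  rw [← happly, ← Complex.coe_smul, DoubleCentralizer.smul_fst, DoubleCentralizer.one_fst]
  simp [mul_smul_comm]

variable [PartialOrder A] [StarOrderedRing A] (f : A →ₚ[ℂ] ℂ)

theorem map_star_fst_mul_fst_le (m : 𝓜(ℂ, A)) (a : A) :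
    f (star (m.fst a) * m.fst a) ≤ (‖m‖ : ℂ) ^ 2 * f (star a * a) := by
  obtain ⟨n, hn⟩ := exists_norm_sq_smul_sub_star_fst_mul_fst_eq m
  have hnonneg := f.map_nonneg (star_mul_self_nonneg (n.fst a))
  rwa [← hn, map_sub, map_smul, smul_eq_mul, sub_nonneg] at hnonneg

/-- The action of a multiplier on the pre-Hilbert space of a positive functional. -/
noncomputable def multiplierPreGNS (m : 𝓜(ℂ, A)) : f.PreGNS →L[ℂ] f.PreGNS :=
  (f.toPreGNS.toLinearMap ∘ₗ m.fst.toLinearMap ∘ₗ f.ofPreGNS.toLinearMap).mkContinuous ‖m‖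
    fun x => by
      rw [← sq_le_sq₀ (by positivity) (by positivity), mul_pow, ← Complex.real_le_real]
      push_cast
      rw [f.preGNS_norm_sq, f.preGNS_norm_sq]
      exact map_star_fst_mul_fst_le f m (f.ofPreGNS x)

theorem completion_multiplierPreGNS_apply_coe (m : 𝓜(ℂ, A)) (x : f.PreGNS) :
    (multiplierPreGNS f m).completion x = (multiplierPreGNS f m x : f.PreGNS) :=
  ContinuousLinearMap.completion_apply_coe _ _

variable {f} in
theorem gns_ext {S T : f.GNS →L[ℂ] f.GNS} (h : ∀ x : f.PreGNS, S x = T x) : S = T :=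
  ContinuousLinearMap.ext fun x =>
    Completion.induction_on x (isClosed_eq S.continuous T.continuous) h

/-- The GNS representation of a positive functional on `A`, extended to the multipliers of `A`. -/
noncomputable def multiplierGNS : 𝓜(ℂ, A) →⋆ₙₐ[ℂ] (f.GNS →L[ℂ] f.GNS) where
  toFun m := (multiplierPreGNS f m).completion
  map_smul' c m := gns_ext fun x => by
    rw [MonoidHom.id_apply, smul_apply, completion_multiplierPreGNS_apply_coe,
      completion_multiplierPreGNS_apply_coe, ← Completion.coe_smul]
    rfl
  map_zero' := gns_ext fun x => by
    rw [completion_multiplierPreGNS_apply_coe, zero_apply, ← Completion.coe_zero]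
    rfl
  map_add' m n := gns_ext fun x => by
    rw [add_apply, completion_multiplierPreGNS_apply_coe, completion_multiplierPreGNS_apply_coe,
      completion_multiplierPreGNS_apply_coe, ← Completion.coe_add]
    rfl
  map_mul' m n := gns_ext fun x => by
    rw [mul_apply_eq_comp, completion_multiplierPreGNS_apply_coe,
      completion_multiplierPreGNS_apply_coe, completion_multiplierPreGNS_apply_coe]
    rfl
  map_star' m := by
    refine (ContinuousLinearMap.eq_adjoint_iff _ _).2 fun x y => ?_
    induction x, y using Completion.induction_on₂ with
    | hp => apply isClosed_eq <;> fun_prop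
    | ih x y =>
      have hadjoint := star_mul_star_fst_apply (star m) (f.ofPreGNS x) (f.ofPreGNS y)
      rw [star_star] at hadjoint
      rw [completion_multiplierPreGNS_apply_coe, completion_multiplierPreGNS_apply_coe,
        Completion.inner_coe, Completion.inner_coe, f.preGNS_inner_def, f.preGNS_inner_def]
      exact congrArg f hadjoint.symm

theorem multiplierGNS_apply_toPreGNS (m : 𝓜(ℂ, A)) (a : A) :
    multiplierGNS f m (f.toPreGNS a : f.PreGNS) = (f.toPreGNS (m.fst a) : f.PreGNS) :=
  completion_multiplierPreGNS_apply_coe f m (f.toPreGNS a)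

theorem norm_toPreGNS_sq (a : A) : ((‖f.toPreGNS a‖ : ℂ)) ^ 2 = f (star a * a) := by
  rw [f.preGNS_norm_sq, f.ofPreGNS_toPreGNS]

variable {f} in
theorem multiplierGNS_injective (hf : ∀ x, f (star x * x) = 0 → x = 0) :
    Function.Injective (multiplierGNS f) := by
  refine (injective_iff_map_eq_zero _).2 fun m hm => ?_
  have hfst : m.fst = 0 := ContinuousLinearMap.ext fun a => by
    have hcoe := multiplierGNS_apply_toPreGNS f m a
    rw [hm, zero_apply] at hcoe
    have hnorm : 0 = ‖f.toPreGNS (m.fst a)‖ := by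
      simpa only [norm_zero, Completion.norm_coe] using congrArg norm hcoe
    refine hf _ ?_
    rw [← norm_toPreGNS_sq, ← hnorm, Complex.ofReal_zero, zero_pow two_ne_zero]
  rw [← norm_eq_zero, ← DoubleCentralizer.norm_fst, hfst, norm_zero]

variable {f} in
theorem isometry_multiplierGNS (hf : ∀ x, f (star x * x) = 0 → x = 0) :
    Isometry (multiplierGNS f) :=
  NonUnitalStarAlgHom.isometry _ (multiplierGNS_injective hf)

theorem continuous_toPreGNS : Continuous f.toPreGNS := by
  obtain ⟨C, hC⟩ := f.exists_norm_apply_le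
  refine AddMonoidHomClass.continuous_of_bound f.toPreGNS (√C) fun a => ?_
  rw [← sq_le_sq₀ (by positivity) (by positivity)]
  calc ‖f.toPreGNS a‖ ^ 2
      = ‖f (star a * a)‖ := by
        rw [← norm_toPreGNS_sq, norm_pow, Complex.norm_real, norm_norm]
    _ ≤ C * ‖star a * a‖ := hC _
    _ = (√C * ‖a‖) ^ 2 := by
        rw [CStarRing.norm_star_mul_self, mul_pow, Real.sq_sqrt C.coe_nonneg, sq ‖a‖]

theorem separableSpace_gns [TopologicalSpace.SeparableSpace A] :
    TopologicalSpace.SeparableSpace f.GNS := by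
  have hdense : DenseRange ((↑) ∘ f.toPreGNS : A → f.GNS) :=
    Completion.denseRange_coe.comp f.toPreGNS.surjective.denseRange (Completion.continuous_coe _)
  exact hdense.separableSpace ((Completion.continuous_coe _).comp (continuous_toPreGNS f))

end MultiplierRepresentation

theorem isometry_coeHom (A : Type*) [NonUnitalCStarAlgebra A] :
    Isometry (DoubleCentralizer.coeHom (𝕜 := ℂ) (A := A)) := by
  refine NonUnitalStarAlgHom.isometry _ ((injective_iff_map_eq_zero _).2 fun a ha => ?_)
  have hmul : a * star a = 0 := congrArg (fun m : 𝓜(ℂ, A) => m.fst (star a)) ha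
  exact CStarRing.mul_star_self_eq_zero_iff a |>.1 hmul

section Copies

open TopologicalSpace

theorem exists_isometry_multiplierAlgebra (A : Type*) [NonUnitalCStarAlgebra A]
    [SeparableSpace A] :
    ∃ φ : 𝓜(ℂ, A) →⋆ₙₐ[ℂ] BoundedOps,
      Isometry φ ∧ Set.range φ ⊆ (Set.univ \ compactOps) ∪ {0} := by
  let _ : PartialOrder A := CStarAlgebra.spectralOrder A
  have _ : StarOrderedRing A := CStarAlgebra.spectralOrderedRing A
  obtain ⟨f, hf⟩ := exists_faithful_positiveLinearMap A
  have := separableSpace_gns f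
  obtain ⟨Ψ, hΨ, hrange⟩ := exists_isometry_range_subset_noncompact f.GNS
  exact ⟨Ψ.comp (multiplierGNS f), hΨ.comp (isometry_multiplierGNS hf),
    (Set.range_comp_subset_range (multiplierGNS f) Ψ).trans hrange⟩

theorem exists_isometry_cStarAlgebra (A : Type*) [NonUnitalCStarAlgebra A] [SeparableSpace A] :
    ∃ φ : A →⋆ₙₐ[ℂ] BoundedOps,
      Isometry φ ∧ Set.range φ ⊆ (Set.univ \ compactOps) ∪ {0} := by
  obtain ⟨φ, hφ, hrange⟩ := exists_isometry_multiplierAlgebra A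
  exact ⟨φ.comp DoubleCentralizer.coeHom, hφ.comp (isometry_coeHom A),
    (Set.range_comp_subset_range (DoubleCentralizer.coeHom (𝕜 := ℂ)) φ).trans hrange⟩

theorem IsUniformAlgebra.exists_isometry {X : Type*} [NonUnitalNormedCommRing X]
    [NormedSpace ℂ X] [IsScalarTower ℂ X X] [SMulCommClass ℂ X X] [CompleteSpace X]
    [SeparableSpace X] (hX : IsUniformAlgebra X) :
    ∃ φ : X →ₙₐ[ℂ] BoundedOps,
      Isometry φ ∧ Set.range φ ⊆ (Set.univ \ compactOps) ∪ {0} := by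
  obtain ⟨θ, hθ⟩ := hX.exists_isometry_ellInfty
  have := separableSpace_lp ℂ (p := 2) ENNReal.ofNat_ne_top fun _ : ℕ => ℂ
  obtain ⟨Ψ, hΨ, hrange⟩ := exists_isometry_range_subset_noncompact EllTwo
  let Δ : EllInfty →⋆ₙₐ[ℂ] BoundedOps := diagonal ℕ ℂ
  exact ⟨((Ψ.comp Δ : EllInfty →⋆ₙₐ[ℂ] BoundedOps) : EllInfty →ₙₐ[ℂ] BoundedOps).comp θ,
    (hΨ.comp isometry_diagonal).comp hθ,
    (Set.range_comp_subset_range (Δ ∘ θ) Ψ).trans hrange⟩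

end Copies

theorem mainTheorem8_general :
    (∀ (X : Type*) [NonUnitalNormedCommRing X] [NormedSpace ℂ X] [IsScalarTower ℂ X X]
        [SMulCommClass ℂ X X] [CompleteSpace X] [TopologicalSpace.SeparableSpace X],
        IsUniformAlgebra X →
        ∃ φ : X →ₙₐ[ℂ] BoundedOps,
          Isometry φ ∧ Set.range φ ⊆ (Set.univ \ compactOps) ∪ {0}) ∧
    (∀ (A : Type*) [NonUnitalCStarAlgebra A] [TopologicalSpace.SeparableSpace A],
        ∃ φ : A →⋆ₙₐ[ℂ] BoundedOps,
          Isometry φ ∧ Set.range φ ⊆ (Set.univ \ compactOps) ∪ {0}) ∧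
    (∀ (A : Type*) [NonUnitalCStarAlgebra A] [TopologicalSpace.SeparableSpace A],
        ∃ φ : 𝓜(ℂ, A) →⋆ₙₐ[ℂ] BoundedOps,
          Isometry φ ∧ Set.range φ ⊆ (Set.univ \ compactOps) ∪ {0}) ∧
    (∃ Φ : EllInfty →⋆ₐ[ℂ] BoundedOps,
        (∀ (f : EllInfty) (g : EllTwo) (n : ℕ), Φ f g n = f n * g n) ∧
        Isometry Φ ∧ Φ '' cZero = compactOps ∩ Set.range Φ) :=
  ⟨fun _ _ _ _ _ _ _ hX => hX.exists_isometry,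
    fun A _ _ => exists_isometry_cStarAlgebra A, fun A _ _ => exists_isometry_multiplierAlgebra A,
    diagonal ℕ ℂ, diagonal_apply, isometry_diagonal, diagonal_image_cZero⟩

theorem mainTheorem8 :
    -- (1), uniform algebras: an isometric copy as an algebra
    (∀ (X : Type*) [NonUnitalNormedCommRing X] [NormedSpace ℂ X] [IsScalarTower ℂ X X]
        [SMulCommClass ℂ X X] [CompleteSpace X] [TopologicalSpace.SeparableSpace X],
        IsUniformAlgebra X → compactElements X = {0} →
        ∃ φ : X →ₙₐ[ℂ] BoundedOps,
          Isometry φ ∧ Set.range φ ⊆ (Set.univ \ compactOps) ∪ {0}) ∧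
    -- (1), abelian C⋆-algebras: an isometric copy as a C⋆-algebra
    (∀ (X : Type*) [NonUnitalCommCStarAlgebra X] [TopologicalSpace.SeparableSpace X],
        compactElements X = {0} →
        ∃ φ : X →⋆ₙₐ[ℂ] BoundedOps,
          Isometry φ ∧ Set.range φ ⊆ (Set.univ \ compactOps) ∪ {0}) ∧
    -- (2), multiplier algebras of separable non-unital C⋆-algebras
    (∀ (A : Type*) [NonUnitalCStarAlgebra A] [TopologicalSpace.SeparableSpace A],
        ¬ HasUnit A → compactElements A = {0} →
        ∃ φ : 𝓜(ℂ, A) →⋆ₙₐ[ℂ] BoundedOps,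
          Isometry φ ∧ Set.range φ ⊆ (Set.univ \ compactOps) ∪ {0}) ∧
    -- the diagonal embedding of `ℓ∞` in `B(ℓ₂)`
    (∃ Φ : EllInfty →⋆ₐ[ℂ] BoundedOps,
        (∀ (f : EllInfty) (g : EllTwo) (n : ℕ), Φ f g n = f n * g n) ∧
        Isometry Φ ∧ Φ '' cZero = compactOps ∩ Set.range Φ) :=
  have ⟨hUniform, hCStar, hMultiplier, hDiagonal⟩ := mainTheorem8_general
  ⟨fun X _ _ _ _ _ _ hX _ => hUniform X hX, fun X _ _ _ => hCStar X,
    fun A _ _ _ _ => hMultiplier A, hDiagonal⟩
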